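/- A (bivariate) copula is a function $C\colon[0,1]^2\to[0,1]$ with $C(x,0)=C(0,x)=0$ and $C(x,1)=C(1,x)=x$ for all $x\in[0,1]$ that is $2$-increasing, i.e. $C(u_2,v_2)-C(u_2,v_1)-C(u_1,v_2)+C(u_1,v_1)\ge 0$ whenever $u_1\le u_2$ and $v_1\le v_2$ in $[0,1]$. A quasi-copula is a function $Q\colon[0,1]^2\to[0,1]$ that satisfies the same boundary conditions, is non-decreasing in each variable, and satisfies $|Q(u_1,v_1)-Q(u_2,v_2)|\le|u_1-u_2|+|v_1-v_2|$ for all $u_1,v_1,u_2,v_2\in[0,1]$; it is proper if it is not a copula. Let $W(u,v)=\max(0,u+v-1)$ and $M(u,v)=\min(u,v)$. Gini's gamma of a copula $C$ is $$\gamma(C)=4\int_0^1\left[C(u,u)+C(u,1-u)\right]du-2 .$$ For $t\in[-1,1]$ let $\overline{G}_t(u,v)=\sup\{C(u,v)\colon C\text{ a copula with }\gamma(C)=t\}$, $(u,v)\in[0,1]^2$, be the pointwise supremum of the set of copulas whose Gini's gamma equals $t$. Then the following hold, where (b), (c) and (d) are for every $t\in[-1,1]$: (a) $\overline{G}_{-1}=W$;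 (b) $\overline{G}_t$ is a proper quasi-copula if and only if $-1<t<0$; (c) $\overline{G}_t$ is a copula different from $M$ and $W$ if and only if $0\le t<1/2$; (d) $\overline{G}_t=M$ if and only if $1/2\le t\le 1$. -/

import Mathlib

open MeasureTheory

namespace GiniGamma

/-- A (bivariate) copula: a function on the unit square with values in `[0,1]`, satisfying the
boundary conditions and the 2-increasing property. -/
structure IsCopula (C : unitInterval → unitInterval → ℝ) : Prop where
  mem_Icc : ∀ u v, C u v ∈ Set.Icc (0 : ℝ) 1
  right_zero : ∀ x, C x 0 = 0
  left_zero : ∀ x, C 0 x = 0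
  right_one : ∀ x, C x 1 = (x : ℝ)
  left_one : ∀ x, C 1 x = (x : ℝ)
  two_increasing : ∀ u₁ u₂ v₁ v₂, u₁ ≤ u₂ → v₁ ≤ v₂ →
    0 ≤ C u₂ v₂ - C u₂ v₁ - C u₁ v₂ + C u₁ v₁

/-- A (bivariate) quasi-copula: the boundary conditions of copulas, monotonicity in each
variable, and the Lipschitz condition. -/
structure IsQuasiCopula (Q : unitInterval → unitInterval → ℝ) : Prop where
  mem_Icc : ∀ u v, Q u v ∈ Set.Icc (0 : ℝ) 1
  right_zero : ∀ x, Q x 0 = 0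
  left_zero : ∀ x, Q 0 x = 0
  right_one : ∀ x, Q x 1 = (x : ℝ)
  left_one : ∀ x, Q 1 x = (x : ℝ)
  mono_left : ∀ u₁ u₂ v, u₁ ≤ u₂ → Q u₁ v ≤ Q u₂ v
  mono_right : ∀ u v₁ v₂, v₁ ≤ v₂ → Q u v₁ ≤ Q u v₂
  lipschitz : ∀ u₁ v₁ u₂ v₂,
    |Q u₁ v₁ - Q u₂ v₂| ≤ |(u₁ : ℝ) - (u₂ : ℝ)| + |(v₁ : ℝ) - (v₂ : ℝ)|

/-- A proper quasi-copula is a quasi-copula that is not a copula. -/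
def IsProperQuasiCopula (Q : unitInterval → unitInterval → ℝ) : Prop :=
  IsQuasiCopula Q ∧ ¬ IsCopula Q

/-- The lower Fréchet–Hoeffding bound `W(u,v) = max(0, u+v-1)`. -/
def W (u v : unitInterval) : ℝ := max 0 ((u : ℝ) + (v : ℝ) - 1)

/-- The upper Fréchet–Hoeffding bound `M(u,v) = min(u,v)`. -/
def M (u v : unitInterval) : ℝ := min (u : ℝ) (v : ℝ)

/-- Gini's gamma `γ(C) = 4 ∫₀¹ [C(u,u) + C(u,1-u)] du - 2`; here `unitInterval.symm u` is `1-u`,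
and the integral is over `[0,1]` with Lebesgue measure. -/
noncomputable def gamma (C : unitInterval → unitInterval → ℝ) : ℝ :=
  4 * (∫ u : unitInterval, (C u u + C u (unitInterval.symm u))) - 2

/-- The set of copulas whose Gini's gamma equals `t`. -/
def copulasWithGamma (t : ℝ) : Set (unitInterval → unitInterval → ℝ) :=
  {C | IsCopula C ∧ gamma C = t}

/-- The pointwise supremum of the set of copulas whose Gini's gamma equals `t`. For every
`t ∈ [-1,1]` this set is non-empty and its values are bounded by `1`. -/
noncomputable def Gsup (t : ℝ) (u v : unitInterval) : ℝ :=
  sSup {x : ℝ | ∃ C ∈ copulasWithGamma t, x = C u v}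

end GiniGamma

namespace GiniGamma

/-! ### Elementary properties of copulas -/

namespace IsCopula

variable {C : unitInterval → unitInterval → ℝ} (hC : IsCopula C)
include hC

/-! Fix a point `(a, b)`. Every copula `C` dominates the copula `low a b d` with `d = C a b`
(`IsCopula.low_le`), and gamma is monotone, so `gamma (low a b d) ≤ gamma C`. Conversely, a copula
with gamma at most `t` can be raised to gamma exactly `t` by mixing it with `M`
(`IsCopula.exists_ge`). The supremum at `(a, b)` is thus governed by which `d` satisfy `gamma (low a
b d) ≤ t`.

Integrating piecewise gives `gamma (low a b d) ≥ 6 d (d - (a + b - 1)) - (a - b)² - 1`, with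
equality when `|a - b|` is at most both `d` and `d - (a + b - 1)`. Solving the quadratic bounds the
supremum by `rootBound`. For `t ≥ 0` the bound is sharp once capped by `M` (`Gsup_eq_of_nonneg`):
away from the equality region the cap is already reached at a nearer point, and monotonicity carries
it outwards.

The sign of `t` decides the 2-increasing property. The mixed derivative of `rootBound` is
nonnegative where `(2a - 1)(2b - 1) ≤ (t + 1)/3`. For `t ≥ 0` this holds wherever `rootBound` is the
active term of the minimum, and comparing one-sided derivatives across the kinks gives a copula
(`isCopula_Gsup`). For `-1 < t < 0` it fails at an active point of the diagonal, and a small square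
there has negative mass (`not_isCopula_Gsup`). The threshold `1/2` is where `rootBound` reaches `M`
at `(1/2, 1/2)`. For `t = -1` only `W` has the required gamma. -/

lemma mono_left {u₁ u₂ : unitInterval} (v : unitInterval) (h : u₁ ≤ u₂) : C u₁ v ≤ C u₂ v := by
  have := hC.two_increasing u₁ u₂ 0 v h v.2.1
  rw [hC.right_zero, hC.right_zero] at this
  linarith

lemma mono_right (u : unitInterval) {v₁ v₂ : unitInterval} (h : v₁ ≤ v₂) : C u v₁ ≤ C u v₂ := by
  have := hC.two_increasing 0 u v₁ v₂ u.2.1 h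
  rw [hC.left_zero, hC.left_zero] at this
  linarith

lemma sub_left_le (u₁ u₂ v : unitInterval) : C u₁ v - C u₂ v ≤ max 0 ((u₁ : ℝ) - u₂) := by
  rcases le_total u₁ u₂ with h | h
  · have := hC.mono_left v h
    exact le_max_of_le_left (by linarith)
  · have := hC.two_increasing u₂ u₁ v 1 h v.2.2
    rw [hC.right_one, hC.right_one] at this
    exact le_max_of_le_right (by linarith)

lemma sub_right_le (u v₁ v₂ : unitInterval) : C u v₁ - C u v₂ ≤ max 0 ((v₁ : ℝ) - v₂) := by
  rcases le_total v₁ v₂ with h | h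
  · have := hC.mono_right u h
    exact le_max_of_le_left (by linarith)
  · have := hC.two_increasing u 1 v₂ v₁ u.2.2 h
    rw [hC.left_one, hC.left_one] at this
    exact le_max_of_le_right (by linarith)

lemma sub_le (u₁ v₁ u₂ v₂ : unitInterval) :
    C u₁ v₁ - C u₂ v₂ ≤ max 0 ((u₁ : ℝ) - u₂) + max 0 ((v₁ : ℝ) - v₂) := by
  have h1 := hC.sub_left_le u₁ u₂ v₁
  have h2 := hC.sub_right_le u₂ v₁ v₂
  linarith

lemma lipschitz (u₁ v₁ u₂ v₂ : unitInterval) :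
    |C u₁ v₁ - C u₂ v₂| ≤ |(u₁ : ℝ) - u₂| + |(v₁ : ℝ) - v₂| := by
  have h1 := hC.sub_le u₁ v₁ u₂ v₂
  have h2 := hC.sub_le u₂ v₂ u₁ v₁
  have e1 : max 0 ((u₁ : ℝ) - u₂) ≤ |(u₁ : ℝ) - u₂| := max_le (abs_nonneg _) (le_abs_self _)
  have e2 : max 0 ((v₁ : ℝ) - v₂) ≤ |(v₁ : ℝ) - v₂| := max_le (abs_nonneg _) (le_abs_self _)
  have e3 : max 0 ((u₂ : ℝ) - u₁) ≤ |(u₁ : ℝ) - u₂| :=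
    max_le (abs_nonneg _) (abs_sub_comm (u₂ : ℝ) u₁ ▸ le_abs_self _)
  have e4 : max 0 ((v₂ : ℝ) - v₁) ≤ |(v₁ : ℝ) - v₂| :=
    max_le (abs_nonneg _) (abs_sub_comm (v₂ : ℝ) v₁ ▸ le_abs_self _)
  exact abs_sub_le_iff.2 ⟨by linarith, by linarith⟩

lemma le_left (u v : unitInterval) : C u v ≤ u := by
  simpa [hC.right_one] using hC.mono_right u (v₁ := v) (v₂ := 1) v.2.2

lemma le_right (u v : unitInterval) : C u v ≤ v := by
  simpa [hC.left_one] using hC.mono_left (u₁ := u) (u₂ := 1) v u.2.2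

lemma add_sub_one_le (u v : unitInterval) : (u : ℝ) + v - 1 ≤ C u v := by
  have := hC.two_increasing u 1 v 1 u.2.2 v.2.2
  rw [hC.right_one, hC.left_one, hC.right_one] at this
  simp only [Set.Icc.coe_one] at this
  linarith

lemma continuous : Continuous fun p : unitInterval × unitInterval ↦ C p.1 p.2 := by
  refine continuous_iff_continuousAt.2 fun p ↦ ?_
  rw [ContinuousAt, tendsto_iff_dist_tendsto_zero]
  refine squeeze_zero (fun _ ↦ dist_nonneg)
    (g := fun q : unitInterval × unitInterval ↦ |(q.1 : ℝ) - p.1| + |(q.2 : ℝ) - p.2|)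
    (fun q ↦ hC.lipschitz _ _ _ _) ?_
  have : Continuous fun q : unitInterval × unitInterval ↦
      |(q.1 : ℝ) - p.1| + |(q.2 : ℝ) - p.2| := by fun_prop
  simpa using this.tendsto p

lemma continuous_diag : Continuous fun u : unitInterval ↦ C u u + C u (unitInterval.symm u) :=
  (hC.continuous.comp (by fun_prop : Continuous fun u : unitInterval ↦ (u, u))).add
    (hC.continuous.comp (by fun_prop : Continuous fun u : unitInterval ↦ (u, unitInterval.symm u)))

end IsCopula

/-! ### Mixtures of copulas, monotonicity and affinity of gamma -/

lemma integrable_of_continuous {f : unitInterval → ℝ} (hf : Continuous f) : Integrable f :=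
  hf.integrable_of_hasCompactSupport (HasCompactSupport.of_compactSpace f)

lemma integral_unitInterval_eq (F : ℝ → ℝ) : ∫ u : unitInterval, F u = ∫ x in (0 : ℝ)..1, F x := by
  rw [intervalIntegral.integral_of_le zero_le_one, ← integral_Icc_eq_integral_Ioc]
  exact integral_subtype_comap measurableSet_Icc F

/-- A convex combination of two copulas is a copula. -/
lemma IsCopula.convexComb {C D : unitInterval → unitInterval → ℝ} (hC : IsCopula C)
    (hD : IsCopula D) {r : ℝ} (h0 : 0 ≤ r) (h1 : r ≤ 1) :
    IsCopula fun u v ↦ (1 - r) * C u v + r * D u v where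
  mem_Icc u v := by
    have a := hC.mem_Icc u v
    have b := hD.mem_Icc u v
    exact convex_Icc (0 : ℝ) 1 a b (sub_nonneg.2 h1) h0 (by ring)
  right_zero x := by simp [hC.right_zero, hD.right_zero]
  left_zero x := by simp [hC.left_zero, hD.left_zero]
  right_one x := by rw [hC.right_one, hD.right_one]; ring
  left_one x := by rw [hC.left_one, hD.left_one]; ring
  two_increasing u₁ u₂ v₁ v₂ hu hv := by
    have a := mul_nonneg (sub_nonneg.2 h1) (hC.two_increasing u₁ u₂ v₁ v₂ hu hv)
    have b := mul_nonneg h0 (hD.two_increasing u₁ u₂ v₁ v₂ hu hv)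
    linarith

lemma gamma_convexComb {C D : unitInterval → unitInterval → ℝ} (hC : IsCopula C)
    (hD : IsCopula D) (r : ℝ) :
    gamma (fun u v ↦ (1 - r) * C u v + r * D u v) = (1 - r) * gamma C + r * gamma D := by
  have : ∫ u : unitInterval, (((1 - r) * C u u + r * D u u) +
        ((1 - r) * C u (unitInterval.symm u) + r * D u (unitInterval.symm u))) =
      (1 - r) * (∫ u : unitInterval, (C u u + C u (unitInterval.symm u))) +
        r * ∫ u : unitInterval, (D u u + D u (unitInterval.symm u)) := by
    rw [← integral_const_mul, ← integral_const_mul, ← integral_add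
      ((integrable_of_continuous hC.continuous_diag).const_mul _)
      ((integrable_of_continuous hD.continuous_diag).const_mul _)]
    congr 1
    ext u
    ring
  simp only [gamma]
  rw [this]
  ring

lemma gamma_mono {C D : unitInterval → unitInterval → ℝ} (hC : IsCopula C) (hD : IsCopula D)
    (h : ∀ u v, C u v ≤ D u v) : gamma C ≤ gamma D := by
  have := integral_mono (integrable_of_continuous hC.continuous_diag)
    (integrable_of_continuous hD.continuous_diag) (fun u ↦ add_le_add (h u u) (h u _))
  simp only [gamma]
  linarith

lemma isCopula_M : IsCopula M where
  mem_Icc u v := ⟨le_min u.2.1 v.2.1, (min_le_left _ _).trans u.2.2⟩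
  right_zero x := by simpa [M] using x.2.1
  left_zero x := by simpa [M] using x.2.1
  right_one x := by simpa [M] using x.2.2
  left_one x := by simpa [M] using x.2.2
  two_increasing u₁ u₂ v₁ v₂ hu hv := by
    have hu' : (u₁ : ℝ) ≤ u₂ := hu
    have hv' : (v₁ : ℝ) ≤ v₂ := hv
    simp only [M]
    grind

/-! ### The smallest copula with a prescribed value at a point -/

/-- The smallest copula taking the value `d` at `(a, b)`. -/
noncomputable def low (a b d : ℝ) (u v : ℝ) : ℝ :=
  max (max 0 (u + v - 1)) (d - max 0 (a - u) - max 0 (b - v))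

/-- A convex function of a sum, here `max c`, is supermodular. -/
lemma max_add_supermodular (c : ℝ) {x₁ x₂ y₁ y₂ : ℝ} (hx : x₁ ≤ x₂) (hy : y₁ ≤ y₂) :
    max c (x₁ + y₂) + max c (x₂ + y₁) ≤ max c (x₂ + y₂) + max c (x₁ + y₁) := by
  grind

/-- On each of the four quadrants with corner `(a, b)`, `low` has the form `max c (f u + g v)` with
`f`, `g` nondecreasing, so supermodularity applies. A general rectangle is cut along `u = a` and `v
= b`, and the masses add. -/
lemma low_two_increasing {a b d : ℝ} (hd0 : 0 ≤ d) (hd1 : a + b - 1 ≤ d)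
    {u₁ u₂ v₁ v₂ : ℝ} (hu : u₁ ≤ u₂) (hv : v₁ ≤ v₂) :
    0 ≤ low a b d u₂ v₂ - low a b d u₂ v₁ - low a b d u₁ v₂ + low a b d u₁ v₁ := by
  have hLL : ∀ u v, u ≤ a → v ≤ b → low a b d u v = max 0 (u + (v - (a + b - d))) := by
    intro u v h1 h2; simp only [low]; grind
  have hLR : ∀ u v, u ≤ a → b ≤ v → low a b d u v = max 0 (u + max (v - 1) (d - a)) := by
    intro u v h1 h2; simp only [low]; grind
  have hRL : ∀ u v, a ≤ u → v ≤ b → low a b d u v = max 0 (max (u - 1) (d - b) + v) := by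
    intro u v h1 h2; simp only [low]; grind
  have hRR : ∀ u v, a ≤ u → b ≤ v → low a b d u v = max d (u + (v - 1)) := by
    intro u v h1 h2; simp only [low]; grind
  have kLL : ∀ u₁ u₂ v₁ v₂, u₁ ≤ u₂ → v₁ ≤ v₂ → u₂ ≤ a → v₂ ≤ b →
      0 ≤ low a b d u₂ v₂ - low a b d u₂ v₁ - low a b d u₁ v₂ + low a b d u₁ v₁ := by
    intro u₁ u₂ v₁ v₂ hu hv h1 h2
    rw [hLL _ _ h1 h2, hLL _ _ h1 (hv.trans h2), hLL _ _ (hu.trans h1) h2,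
      hLL _ _ (hu.trans h1) (hv.trans h2)]
    linarith [max_add_supermodular 0 hu (sub_le_sub_right hv (a + b - d))]
  have kLR : ∀ u₁ u₂ v₁ v₂, u₁ ≤ u₂ → v₁ ≤ v₂ → u₂ ≤ a → b ≤ v₁ →
      0 ≤ low a b d u₂ v₂ - low a b d u₂ v₁ - low a b d u₁ v₂ + low a b d u₁ v₁ := by
    intro u₁ u₂ v₁ v₂ hu hv h1 h2
    rw [hLR _ _ h1 (h2.trans hv), hLR _ _ h1 h2, hLR _ _ (hu.trans h1) (h2.trans hv),
      hLR _ _ (hu.trans h1) h2]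
    linarith [max_add_supermodular 0 hu (max_le_max_right (d - a) (sub_le_sub_right hv 1))]
  have kRL : ∀ u₁ u₂ v₁ v₂, u₁ ≤ u₂ → v₁ ≤ v₂ → a ≤ u₁ → v₂ ≤ b →
      0 ≤ low a b d u₂ v₂ - low a b d u₂ v₁ - low a b d u₁ v₂ + low a b d u₁ v₁ := by
    intro u₁ u₂ v₁ v₂ hu hv h1 h2
    rw [hRL _ _ (h1.trans hu) h2, hRL _ _ (h1.trans hu) (hv.trans h2), hRL _ _ h1 h2,
      hRL _ _ h1 (hv.trans h2)]
    linarith [max_add_supermodular 0 (max_le_max_right (d - b) (sub_le_sub_right hu 1)) hv]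
  have kRR : ∀ u₁ u₂ v₁ v₂, u₁ ≤ u₂ → v₁ ≤ v₂ → a ≤ u₁ → b ≤ v₁ →
      0 ≤ low a b d u₂ v₂ - low a b d u₂ v₁ - low a b d u₁ v₂ + low a b d u₁ v₁ := by
    intro u₁ u₂ v₁ v₂ hu hv h1 h2
    rw [hRR _ _ (h1.trans hu) (h2.trans hv), hRR _ _ (h1.trans hu) h2,
      hRR _ _ h1 (h2.trans hv), hRR _ _ h1 h2]
    linarith [max_add_supermodular d hu (sub_le_sub_right hv 1)]
  have kL : ∀ u₁ u₂, u₁ ≤ u₂ → u₂ ≤ a →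
      0 ≤ low a b d u₂ v₂ - low a b d u₂ v₁ - low a b d u₁ v₂ + low a b d u₁ v₁ := by
    intro u₁ u₂ hu h1
    rcases le_total v₂ b with h | h
    · exact kLL _ _ _ _ hu hv h1 h
    rcases le_total b v₁ with h' | h'
    · exact kLR _ _ _ _ hu hv h1 h'
    linarith [kLL _ _ _ _ hu h' h1 le_rfl, kLR _ _ _ _ hu h h1 le_rfl]
  have kR : ∀ u₁ u₂, u₁ ≤ u₂ → a ≤ u₁ →
      0 ≤ low a b d u₂ v₂ - low a b d u₂ v₁ - low a b d u₁ v₂ + low a b d u₁ v₁ := by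
    intro u₁ u₂ hu h1
    rcases le_total v₂ b with h | h
    · exact kRL _ _ _ _ hu hv h1 h
    rcases le_total b v₁ with h' | h'
    · exact kRR _ _ _ _ hu hv h1 h'
    linarith [kRL _ _ _ _ hu h' h1 le_rfl, kRR _ _ _ _ hu h h1 le_rfl]
  rcases le_total u₂ a with h | h
  · exact kL _ _ hu h
  rcases le_total a u₁ with h' | h'
  · exact kR _ _ hu h'
  linarith [kL _ _ h' le_rfl, kR _ _ h le_rfl]

lemma isCopula_low {a b d : ℝ} (hd0 : 0 ≤ d) (hd1 : a + b - 1 ≤ d) (hda : d ≤ a) (hdb : d ≤ b)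
    (ha : a ≤ 1) (hb : b ≤ 1) : IsCopula fun u v : unitInterval ↦ low a b d u v where
  mem_Icc u v := by
    have h1 := u.2.2
    have h2 := v.2.2
    refine ⟨le_max_of_le_left (le_max_left _ _), ?_⟩
    simp only [low]
    grind
  right_zero x := by
    have h1 := x.2.1
    have h2 := x.2.2
    simp only [low, Set.Icc.coe_zero]
    grind
  left_zero x := by
    have h1 := x.2.1
    have h2 := x.2.2
    simp only [low, Set.Icc.coe_zero]
    grind
  right_one x := by
    have h1 := x.2.1
    have h2 := x.2.2
    simp only [low, Set.Icc.coe_one]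
    grind
  left_one x := by
    have h1 := x.2.1
    have h2 := x.2.2
    simp only [low, Set.Icc.coe_one]
    grind
  two_increasing u₁ u₂ v₁ v₂ hu hv := low_two_increasing hd0 hd1 hu hv

lemma low_self {a b d : ℝ} (hd0 : 0 ≤ d) (hd1 : a + b - 1 ≤ d) : low a b d a b = d := by
  simp [low, hd0, hd1]

/-- Every copula dominates the smallest copula with the same value at a point. -/
lemma IsCopula.low_le {C : unitInterval → unitInterval → ℝ} (hC : IsCopula C)
    (a b u v : unitInterval) : low a b (C a b) u v ≤ C u v := by
  refine max_le (max_le (hC.mem_Icc u v).1 (hC.add_sub_one_le u v)) ?_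
  linarith [hC.sub_le a b u v]

lemma isCopula_W : IsCopula W := by
  -- Prescribing the value `0` at the origin imposes nothing, so `low 0 0 0` is `W` on the square.
  have h := isCopula_low (a := 0) (b := 0) (d := 0) le_rfl (by norm_num) le_rfl le_rfl
    zero_le_one zero_le_one
  convert h using 1
  ext u v
  have h1 := u.2.1
  have h2 := v.2.1
  simp only [W, low]
  grind

/-! ### Gini's gamma of the smallest copula with a prescribed value -/

lemma integral_const_sub_id (c p q : ℝ) :
    ∫ u in p..q, (c - u) = ((c - p) ^ 2 - (c - q) ^ 2) / 2 := by
  rw [intervalIntegral.integral_sub (by simp) (by simp), intervalIntegral.integral_const,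
    integral_id, smul_eq_mul]
  ring

lemma integral_max_zero_sub {p q : ℝ} (c : ℝ) (hpq : p ≤ q) :
    ∫ u in p..q, max 0 (c - u) = (max 0 (c - p) ^ 2 - max 0 (c - q) ^ 2) / 2 := by
  have hI : ∀ x y, IntervalIntegrable (fun u : ℝ ↦ max 0 (c - u)) volume x y := fun x y ↦
    Continuous.intervalIntegrable (by fun_prop) _ _
  have below : ∀ x y, x ≤ y → y ≤ c →
      ∫ u in x..y, max 0 (c - u) = ((c - x) ^ 2 - (c - y) ^ 2) / 2 := by
    intro x y hxy hy
    rw [← integral_const_sub_id]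
    refine intervalIntegral.integral_congr fun u hu ↦ ?_
    rw [Set.uIcc_of_le hxy] at hu
    exact max_eq_right (by linarith [hu.2])
  have above : ∀ x y, x ≤ y → c ≤ x → ∫ u in x..y, max 0 (c - u) = 0 := by
    intro x y hxy hx
    refine (intervalIntegral.integral_congr (g := fun _ ↦ (0 : ℝ)) fun u hu ↦ ?_).trans (by simp)
    rw [Set.uIcc_of_le hxy] at hu
    exact max_eq_left (by simpa using hx.trans hu.1)
  rcases le_total q c with h | h
  · rw [below _ _ hpq h, max_eq_right (by linarith), max_eq_right (by linarith)]
  rcases le_total c p with h' | h'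
  · rw [above _ _ hpq h', max_eq_left (by linarith), max_eq_left (by linarith)]
    ring
  · rw [← intervalIntegral.integral_add_adjacent_intervals (hI p c) (hI c q), below _ _ h' le_rfl,
      above _ _ h le_rfl, max_eq_right (by linarith), max_eq_left (by linarith)]
    ring

lemma continuous_low_diag (a b d : ℝ) : Continuous fun u ↦ low a b d u u := by
  unfold low
  fun_prop

lemma continuous_low_anti (a b d : ℝ) : Continuous fun u ↦ low a b d u (1 - u) := by
  unfold low
  fun_prop

lemma gamma_low (a b d : ℝ) :
    gamma (fun u v : unitInterval ↦ low a b d u v) =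
      4 * ((∫ u in (0 : ℝ)..1, low a b d u u) + ∫ u in (0 : ℝ)..1, low a b d u (1 - u)) - 2 := by
  rw [← intervalIntegral.integral_add ((continuous_low_diag a b d).intervalIntegrable _ _)
    ((continuous_low_anti a b d).intervalIntegrable _ _), ← integral_unitInterval_eq]
  rfl

/-- Along the antidiagonal `low` is a trapezoid supported on `[a - d, 1 - b + d]`, and the stated
product is its area. -/
lemma integral_low_anti {a b d : ℝ} (hd0 : 0 ≤ d) (hd1 : a + b - 1 ≤ d) (hda : d ≤ a)
    (hdb : d ≤ b) : ∫ u in (0 : ℝ)..1, low a b d u (1 - u) = d * (d - (a + b - 1)) := by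
  have hI : ∀ x y, IntervalIntegrable (fun u : ℝ ↦ low a b d u (1 - u)) volume x y := fun x y ↦
    (continuous_low_anti a b d).intervalIntegrable _ _
  have hm : ∀ c x y, IntervalIntegrable (fun u : ℝ ↦ max 0 (c - u)) volume x y := fun c x y ↦
    Continuous.intervalIntegrable (by fun_prop) _ _
  have left : ∫ u in (0 : ℝ)..(a - d), low a b d u (1 - u) = 0 := by
    refine (intervalIntegral.integral_congr (g := fun _ ↦ (0 : ℝ)) fun u hu ↦ ?_).trans (by simp)
    rw [Set.uIcc_of_le (by linarith)] at hu
    obtain ⟨h1, h2⟩ := hu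
    simp only [low]
    grind
  have right : ∫ u in (1 - b + d)..1, low a b d u (1 - u) = 0 := by
    refine (intervalIntegral.integral_congr (g := fun _ ↦ (0 : ℝ)) fun u hu ↦ ?_).trans (by simp)
    rw [Set.uIcc_of_le (by linarith)] at hu
    obtain ⟨h1, h2⟩ := hu
    simp only [low]
    grind
  -- The identity `max 0 x = x + max 0 (-x)` turns the increasing ramp into a decreasing one, so
  -- that `integral_max_zero_sub` covers both.
  have mid : ∫ u in (a - d)..(1 - b + d), low a b d u (1 - u) =
      ∫ u in (a - d)..(1 - b + d), ((1 - b + d - u) - max 0 (a - u) - max 0 (1 - b - u)) := by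
    refine intervalIntegral.integral_congr fun u hu ↦ ?_
    rw [Set.uIcc_of_le (by linarith)] at hu
    obtain ⟨h1, h2⟩ := hu
    simp only [low]
    grind
  rw [← intervalIntegral.integral_add_adjacent_intervals (hI 0 (a - d)) (hI (a - d) 1),
    ← intervalIntegral.integral_add_adjacent_intervals (hI (a - d) (1 - b + d)) (hI _ 1),
    left, right, mid, intervalIntegral.integral_sub
      ((Continuous.intervalIntegrable (by fun_prop) _ _).sub (hm _ _ _)) (hm _ _ _),
    intervalIntegral.integral_sub (Continuous.intervalIntegrable (by fun_prop) _ _) (hm _ _ _),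
    integral_const_sub_id, integral_max_zero_sub _ (by linarith),
    integral_max_zero_sub _ (by linarith), max_eq_right (by linarith : 0 ≤ a - (a - d)),
    max_eq_left (by linarith : a - (1 - b + d) ≤ 0),
    max_eq_right (by linarith : 0 ≤ 1 - b - (a - d)),
    max_eq_left (by linarith : 1 - b - (1 - b + d) ≤ 0)]
  ring

lemma integral_upper_tail (d : ℝ) : ∫ u in ((1 + d) / 2)..1, (2 * u - 1) = (1 - d ^ 2) / 4 := by
  rw [intervalIntegral.integral_sub (Continuous.intervalIntegrable (by fun_prop) _ _) (by simp),
    intervalIntegral.integral_const_mul, integral_id, intervalIntegral.integral_const, smul_eq_mul]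
  ring

lemma integral_tent (a b d p q : ℝ) (hpq : p ≤ q) :
    ∫ u in p..q, (d - max 0 (a - u) - max 0 (b - u)) =
      d * (q - p) - (max 0 (a - p) ^ 2 - max 0 (a - q) ^ 2) / 2 -
        (max 0 (b - p) ^ 2 - max 0 (b - q) ^ 2) / 2 := by
  have hm : ∀ c x y, IntervalIntegrable (fun u : ℝ ↦ max 0 (c - u)) volume x y := fun c x y ↦
    Continuous.intervalIntegrable (by fun_prop) _ _
  rw [intervalIntegral.integral_sub
      ((Continuous.intervalIntegrable (by fun_prop) _ _).sub (hm _ _ _)) (hm _ _ _),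
    intervalIntegral.integral_sub (Continuous.intervalIntegrable (by fun_prop) _ _) (hm _ _ _),
    intervalIntegral.integral_const, integral_max_zero_sub _ hpq, integral_max_zero_sub _ hpq,
    smul_eq_mul]
  ring

lemma integral_low_diag_split (a b d p q : ℝ) :
    ∫ u in (0 : ℝ)..1, low a b d u u = (∫ u in (0 : ℝ)..p, low a b d u u) +
      ((∫ u in p..q, low a b d u u) + ∫ u in q..1, low a b d u u) := by
  have hI : ∀ x y, IntervalIntegrable (fun u : ℝ ↦ low a b d u u) volume x y := fun x y ↦
    (continuous_low_diag a b d).intervalIntegrable _ _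
  rw [intervalIntegral.integral_add_adjacent_intervals (hI p q) (hI q 1),
    intervalIntegral.integral_add_adjacent_intervals (hI 0 p) (hI p 1)]

lemma max_zero_sq_le (x : ℝ) : max 0 x ^ 2 ≤ x ^ 2 := by
  rcases le_total 0 x with h | h
  · rw [max_eq_right h]
  · simpa [max_eq_left h] using sq_nonneg x

/-- The cuts are where `d - (a - u) - (b - u)` vanishes and where `2u - 1 = d`. On the three pieces
`low` is bounded below by `0`, by the tent and by `2u - 1`; then `max 0 x ^ 2 ≤ x ^ 2` at the first
cut and nonnegativity of the squares at the second remove the remaining maxima. -/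
lemma le_integral_low_diag {a b d : ℝ} (hd0 : 0 ≤ d) (hd1 : a + b - 1 ≤ d) (hda : d ≤ a)
    (hdb : d ≤ b) :
    1 / 4 + d * (d - (a + b - 1)) / 2 - (a - b) ^ 2 / 4 ≤ ∫ u in (0 : ℝ)..1, low a b d u u := by
  have hI : ∀ x y, IntervalIntegrable (fun u : ℝ ↦ low a b d u u) volume x y := fun x y ↦
    (continuous_low_diag a b d).intervalIntegrable _ _
  rw [integral_low_diag_split a b d ((a + b - d) / 2) ((1 + d) / 2)]
  have h1 : 0 ≤ ∫ u in (0 : ℝ)..((a + b - d) / 2), low a b d u u :=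
    intervalIntegral.integral_nonneg (by linarith) fun u _ ↦
      le_max_of_le_left (le_max_left _ _)
  have h2 := intervalIntegral.integral_mono_on (μ := volume)
    (a := (a + b - d) / 2) (b := (1 + d) / 2) (by linarith)
    (f := fun u ↦ d - max 0 (a - u) - max 0 (b - u)) (g := fun u ↦ low a b d u u)
    (Continuous.intervalIntegrable (by fun_prop) _ _) (hI _ _) (fun u _ ↦ le_max_right _ _)
  have h3 := intervalIntegral.integral_mono_on (μ := volume) (a := (1 + d) / 2) (b := 1)
    (by linarith) (f := fun u ↦ 2 * u - 1) (g := fun u ↦ low a b d u u)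
    (Continuous.intervalIntegrable (by fun_prop) _ _) (hI _ _)
    (fun u _ ↦ le_max_of_le_left (le_max_of_le_right (by linarith)))
  rw [integral_upper_tail] at h3
  rw [integral_tent _ _ _ _ _ (by linarith)] at h2
  nlinarith [max_zero_sq_le (a - (a + b - d) / 2), max_zero_sq_le (b - (a + b - d) / 2),
    sq_nonneg (max 0 (a - (1 + d) / 2)), sq_nonneg (max 0 (b - (1 + d) / 2))]

lemma quarter_le_integral_low_diag (a b d : ℝ) : 1 / 4 ≤ ∫ u in (0 : ℝ)..1, low a b d u u := by
  have hI : ∀ x y, IntervalIntegrable (fun u : ℝ ↦ low a b d u u) volume x y := fun x y ↦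
    (continuous_low_diag a b d).intervalIntegrable _ _
  -- The midpoint is kept as `(1 + 0) / 2` so that `integral_upper_tail` matches with `d = 0`.
  have h0 := intervalIntegral.integral_add_adjacent_intervals (hI 0 ((1 + 0) / 2)) (hI _ 1)
  have h1 : 0 ≤ ∫ u in (0 : ℝ)..((1 + 0) / 2), low a b d u u :=
    intervalIntegral.integral_nonneg (by norm_num) fun u _ ↦ le_max_of_le_left (le_max_left _ _)
  have h3 := intervalIntegral.integral_mono_on (μ := volume) (a := (1 + 0) / 2) (b := 1)
    (by norm_num) (f := fun u ↦ 2 * u - 1) (g := fun u ↦ low a b d u u)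
    (Continuous.intervalIntegrable (by fun_prop) _ _) (hI _ _)
    (fun u _ ↦ le_max_of_le_left (le_max_of_le_right (by linarith)))
  rw [integral_upper_tail] at h3
  linarith

/-- The conditions on `a - b` say that both `a` and `b` lie between the two cuts `(a + b - d) / 2`
and `(1 + d) / 2`; then every estimate in `le_integral_low_diag` is an equality. -/
lemma integral_low_diag {a b d : ℝ} (hd0 : 0 ≤ d) (hda : d ≤ a)
    (hdb : d ≤ b) (ha : a ≤ 1) (h1 : a - b ≤ d) (h2 : b - a ≤ d)
    (h3 : a - b ≤ d - (a + b - 1)) (h4 : b - a ≤ d - (a + b - 1)) :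
    ∫ u in (0 : ℝ)..1, low a b d u u =
      1 / 4 + d * (d - (a + b - 1)) / 2 - (a - b) ^ 2 / 4 := by
  have left : ∫ u in (0 : ℝ)..((a + b - d) / 2), low a b d u u = 0 := by
    refine (intervalIntegral.integral_congr (g := fun _ ↦ (0 : ℝ)) fun u hu ↦ ?_).trans (by simp)
    rw [Set.uIcc_of_le (by linarith)] at hu
    obtain ⟨h5, h6⟩ := hu
    simp only [low]
    grind
  have right : ∫ u in ((1 + d) / 2)..1, low a b d u u = ∫ u in ((1 + d) / 2)..1, (2 * u - 1) := by
    refine intervalIntegral.integral_congr fun u hu ↦ ?_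
    rw [Set.uIcc_of_le (by linarith)] at hu
    obtain ⟨h5, h6⟩ := hu
    simp only [low]
    grind
  have mid : ∫ u in ((a + b - d) / 2)..((1 + d) / 2), low a b d u u =
      ∫ u in ((a + b - d) / 2)..((1 + d) / 2), (d - max 0 (a - u) - max 0 (b - u)) := by
    refine intervalIntegral.integral_congr fun u hu ↦ ?_
    rw [Set.uIcc_of_le (by linarith)] at hu
    obtain ⟨h5, h6⟩ := hu
    simp only [low]
    grind
  rw [integral_low_diag_split a b d ((a + b - d) / 2) ((1 + d) / 2), left, right, mid,
    integral_upper_tail, integral_tent _ _ _ _ _ (by linarith),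
    max_eq_right (by linarith : 0 ≤ a - (a + b - d) / 2),
    max_eq_right (by linarith : 0 ≤ b - (a + b - d) / 2),
    max_eq_left (by linarith : a - (1 + d) / 2 ≤ 0),
    max_eq_left (by linarith : b - (1 + d) / 2 ≤ 0)]
  ring

lemma gamma_low_eq {a b d : ℝ} (hd0 : 0 ≤ d) (hda : d ≤ a)
    (hdb : d ≤ b) (ha : a ≤ 1) (h1 : a - b ≤ d) (h2 : b - a ≤ d)
    (h3 : a - b ≤ d - (a + b - 1)) (h4 : b - a ≤ d - (a + b - 1)) :
    gamma (fun u v : unitInterval ↦ low a b d u v) =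
      6 * (d * (d - (a + b - 1))) - (a - b) ^ 2 - 1 := by
  rw [gamma_low, integral_low_anti hd0 (by linarith) hda hdb,
    integral_low_diag hd0 hda hdb ha h1 h2 h3 h4]
  ring

lemma gamma_W : gamma W = -1 := by
  have h := gamma_low_eq (a := 0) (b := 0) (d := 0) le_rfl le_rfl le_rfl zero_le_one
    (by norm_num) (by norm_num) (by norm_num) (by norm_num)
  convert h using 1
  · congr 1
    ext u v
    have h1 := u.2.1
    have h2 := v.2.1
    simp only [W, low]
    grind
  · norm_num

lemma gamma_M : gamma M = 1 := by
  -- Uses `min u (1 - u) = (1 - u) - 2 * max 0 (1 / 2 - u)`.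
  have h : (∫ u : unitInterval, (M u u + M u (unitInterval.symm u))) =
      ∫ u in (0 : ℝ)..1, ((1 - u) - 2 * max 0 (1 / 2 - u) + u) := by
    rw [← integral_unitInterval_eq]
    refine integral_congr_ae (Filter.Eventually.of_forall fun u ↦ ?_)
    simp only [M, unitInterval.coe_symm_eq]
    grind
  rw [gamma, h, intervalIntegral.integral_add (Continuous.intervalIntegrable (by fun_prop) _ _)
    (Continuous.intervalIntegrable (by fun_prop) _ _), intervalIntegral.integral_sub
    (Continuous.intervalIntegrable (by fun_prop) _ _)
    (Continuous.intervalIntegrable (by fun_prop) _ _), intervalIntegral.integral_const_mul,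
    integral_max_zero_sub _ zero_le_one, integral_const_sub_id, integral_id]
  norm_num

namespace IsCopula

variable {C : unitInterval → unitInterval → ℝ} (hC : IsCopula C)
include hC

lemma isCopula_low_self (a b : unitInterval) :
    IsCopula fun u v : unitInterval ↦ low a b (C a b) u v :=
  isCopula_low (hC.mem_Icc a b).1 (hC.add_sub_one_le a b) (hC.le_left a b) (hC.le_right a b)
    a.2.2 b.2.2

lemma gamma_low_le (a b : unitInterval) :
    gamma (fun u v : unitInterval ↦ low a b (C a b) u v) ≤ gamma C :=
  gamma_mono (hC.isCopula_low_self a b) hC (hC.low_le a b)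

/-- A lower bound for Gini's gamma in terms of the value of the copula at a point. -/
lemma le_gamma (a b : unitInterval) :
    6 * (C a b * (C a b - (a + b - 1))) - ((a : ℝ) - b) ^ 2 - 1 ≤ gamma C := by
  have h := hC.gamma_low_le a b
  have h2 := le_integral_low_diag (hC.mem_Icc a b).1 (hC.add_sub_one_le a b) (hC.le_left a b)
    (hC.le_right a b)
  rw [gamma_low, integral_low_anti (hC.mem_Icc a b).1 (hC.add_sub_one_le a b) (hC.le_left a b)
    (hC.le_right a b)] at h
  linarith

/-- The diagonal integral of `low` alone already accounts for `-1`, so the antidiagonal area `d (d -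
(a + b - 1))` must vanish, which leaves only the value of `W`. -/
lemma eq_W_of_gamma (h : gamma C = -1) : C = W := by
  ext a b
  have h1 := hC.gamma_low_le a b
  have h2 := quarter_le_integral_low_diag a b (C a b)
  have h3 := (hC.mem_Icc a b).1
  have h4 := hC.add_sub_one_le a b
  rw [gamma_low, integral_low_anti h3 h4 (hC.le_left a b) (hC.le_right a b), h] at h1
  have h5 : C a b * (C a b - (a + b - 1)) = 0 :=
    le_antisymm (by linarith) (mul_nonneg h3 (by linarith))
  rcases mul_eq_zero.1 h5 with h6 | h6
  · simp only [W]
    rw [max_eq_left (by linarith), h6]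
  · simp only [W]
    rw [max_eq_right (by linarith)]
    linarith

end IsCopula

/-! ### The pointwise supremum -/

/-- A copula whose gamma is at most `t` is dominated by a copula whose gamma is `t`. -/
lemma IsCopula.exists_ge {C : unitInterval → unitInterval → ℝ} (hC : IsCopula C) {t : ℝ}
    (ht : gamma C ≤ t) (ht1 : t ≤ 1) : ∃ D ∈ copulasWithGamma t, ∀ u v, C u v ≤ D u v := by
  rcases eq_or_lt_of_le ht with h | h
  · exact ⟨C, ⟨hC, h⟩, fun u v ↦ le_rfl⟩
  have hpos : 0 < 1 - gamma C := by linarith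
  -- The weight solving `(1 - r) * gamma C + r * gamma M = t`, with `gamma M = 1`.
  set r := (t - gamma C) / (1 - gamma C) with hr
  have h0 : 0 ≤ r := div_nonneg (by linarith) hpos.le
  have h1 : r ≤ 1 := (div_le_one hpos).2 (by linarith)
  refine ⟨_, ⟨hC.convexComb isCopula_M h0 h1, ?_⟩, fun u v ↦ ?_⟩
  · rw [gamma_convexComb hC isCopula_M, gamma_M]
    have : r * (1 - gamma C) = t - gamma C := div_mul_cancel₀ _ hpos.ne'
    linarith
  · have : C u v ≤ M u v := le_min (hC.le_left u v) (hC.le_right u v)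
    nlinarith

lemma bddAbove_values (t : ℝ) (u v : unitInterval) :
    BddAbove {x : ℝ | ∃ C ∈ copulasWithGamma t, x = C u v} :=
  ⟨1, by rintro _ ⟨C, hC, rfl⟩; exact (hC.1.mem_Icc u v).2⟩

lemma le_Gsup {t : ℝ} {C : unitInterval → unitInterval → ℝ} (hC : C ∈ copulasWithGamma t)
    (u v : unitInterval) : C u v ≤ Gsup t u v :=
  le_csSup (bddAbove_values t u v) ⟨C, hC, rfl⟩

lemma copulasWithGamma_nonempty {t : ℝ} (ht : -1 ≤ t) (ht1 : t ≤ 1) :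
    (copulasWithGamma t).Nonempty := by
  obtain ⟨D, hD, -⟩ := isCopula_W.exists_ge (gamma_W.trans_le ht) ht1
  exact ⟨D, hD⟩

lemma Gsup_le {t : ℝ} (ht : -1 ≤ t) (ht1 : t ≤ 1) {u v : unitInterval} {x : ℝ}
    (h : ∀ C ∈ copulasWithGamma t, C u v ≤ x) : Gsup t u v ≤ x := by
  obtain ⟨D, hD⟩ := copulasWithGamma_nonempty ht ht1
  refine csSup_le ⟨D u v, D, hD, rfl⟩ ?_
  rintro _ ⟨C, hC, rfl⟩
  exact h C hC

lemma isQuasiCopula_Gsup {t : ℝ} (ht : -1 ≤ t) (ht1 : t ≤ 1) : IsQuasiCopula (Gsup t) := by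
  obtain ⟨D, hD⟩ := copulasWithGamma_nonempty ht ht1
  have key : ∀ u₁ v₁ u₂ v₂ : unitInterval,
      Gsup t u₁ v₁ - Gsup t u₂ v₂ ≤ |(u₁ : ℝ) - u₂| + |(v₁ : ℝ) - v₂| := by
    intro u₁ v₁ u₂ v₂
    rw [sub_le_iff_le_add]
    refine Gsup_le ht ht1 fun C hC ↦ ?_
    have h1 := le_Gsup hC u₂ v₂
    have h2 := (abs_le.1 (hC.1.lipschitz u₁ v₁ u₂ v₂)).2
    linarith
  have eq : ∀ u v x, (∀ C, IsCopula C → C u v = x) → Gsup t u v = x := fun u v x h ↦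
    le_antisymm (Gsup_le ht ht1 fun C hC ↦ (h C hC.1).le)
      ((h D hD.1).symm.le.trans (le_Gsup hD u v))
  exact
    { mem_Icc := fun u v ↦ ⟨(hD.1.mem_Icc u v).1.trans (le_Gsup hD u v),
        Gsup_le ht ht1 fun C hC ↦ (hC.1.mem_Icc u v).2⟩
      right_zero := fun x ↦ eq _ _ _ fun C hC ↦ hC.right_zero x
      left_zero := fun x ↦ eq _ _ _ fun C hC ↦ hC.left_zero x
      right_one := fun x ↦ eq _ _ _ fun C hC ↦ hC.right_one x
      left_one := fun x ↦ eq _ _ _ fun C hC ↦ hC.left_one x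
      mono_left := fun u₁ u₂ v h ↦ Gsup_le ht ht1 fun C hC ↦
        (hC.1.mono_left v h).trans (le_Gsup hC u₂ v)
      mono_right := fun u v₁ v₂ h ↦ Gsup_le ht ht1 fun C hC ↦
        (hC.1.mono_right u h).trans (le_Gsup hC u v₂)
      lipschitz := fun u₁ v₁ u₂ v₂ ↦ abs_sub_le_iff.2 ⟨key u₁ v₁ u₂ v₂, by
        have := key u₂ v₂ u₁ v₁
        rwa [abs_sub_comm (u₂ : ℝ), abs_sub_comm (v₂ : ℝ)] at this⟩ }

lemma Gsup_neg_one : Gsup (-1) = W := by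
  ext u v
  refine le_antisymm (Gsup_le le_rfl (by norm_num) fun C hC ↦ ?_)
    (le_Gsup ⟨isCopula_W, gamma_W⟩ u v)
  rw [hC.1.eq_W_of_gamma hC.2]

/-! ### The supremum in closed form -/

/-- The larger root `x` of `6 x (x - (a + b - 1)) - (a - b)² - 1 = t`. -/
noncomputable def rootBound (t a b : ℝ) : ℝ :=
  ((a + b - 1) + √((a + b - 1) ^ 2 + 2 / 3 * (t + 1) + 2 / 3 * (a - b) ^ 2)) / 2

lemma le_rootBound {t a b d : ℝ} (h : 6 * (d * (d - (a + b - 1))) - (a - b) ^ 2 - 1 ≤ t) :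
    d ≤ rootBound t a b := by
  have : 2 * d - (a + b - 1) ≤
      √((a + b - 1) ^ 2 + 2 / 3 * (t + 1) + 2 / 3 * (a - b) ^ 2) :=
    Real.le_sqrt_of_sq_le (by nlinarith)
  rw [rootBound]
  linarith

lemma rootBound_eq {t a b : ℝ} (ht : -1 ≤ t) :
    6 * (rootBound t a b * (rootBound t a b - (a + b - 1))) - (a - b) ^ 2 - 1 = t := by
  have := Real.sq_sqrt (by nlinarith [sq_nonneg (a + b - 1), sq_nonneg (a - b)] :
    0 ≤ (a + b - 1) ^ 2 + 2 / 3 * (t + 1) + 2 / 3 * (a - b) ^ 2)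
  rw [rootBound]
  linear_combination 3 / 2 * this

lemma rootBound_comm (t a b : ℝ) : rootBound t a b = rootBound t b a := by
  rw [rootBound, rootBound]
  congr 3 <;> ring

lemma Gsup_le_rootBound {t : ℝ} (ht : -1 ≤ t) (ht1 : t ≤ 1) (a b : unitInterval) :
    Gsup t a b ≤ rootBound t a b :=
  Gsup_le ht ht1 fun _ hC ↦ le_rootBound ((hC.1.le_gamma a b).trans hC.2.le)

lemma le_Gsup_of_le {t d : ℝ} (ht1 : t ≤ 1) (a b : unitInterval) (hda : d ≤ a) (hdb : d ≤ b)
    (h1 : |(a : ℝ) - b| ≤ d) (h2 : |(a : ℝ) - b| ≤ d - (a + b - 1))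
    (h : 6 * (d * (d - (a + b - 1))) - ((a : ℝ) - b) ^ 2 - 1 ≤ t) : d ≤ Gsup t a b := by
  have h0 := abs_nonneg ((a : ℝ) - b)
  have hc := isCopula_low (d := d) (by linarith) (by linarith) hda hdb a.2.2 b.2.2
  obtain ⟨D, hD, hle⟩ := hc.exists_ge (t := t) (by
    rw [gamma_low_eq (by linarith) hda hdb a.2.2 (le_of_abs_le h1)
      (by linarith [neg_abs_le ((a : ℝ) - b)])
      (le_of_abs_le h2) (by linarith [neg_abs_le ((a : ℝ) - b)])]
    exact h) ht1
  have h3 := hle a b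
  rw [low_self (by linarith) (by linarith)] at h3
  exact h3.trans (le_Gsup hD a b)

lemma rootBound_sub_nonneg (t a b : ℝ) : 0 ≤ 2 * rootBound t a b - (a + b - 1) := by
  rw [rootBound]
  linarith [Real.sqrt_nonneg ((a + b - 1) ^ 2 + 2 / 3 * (t + 1) + 2 / 3 * (a - b) ^ 2)]

/-- The two conditions of `le_Gsup_of_le` must hold at `d = min a (rootBound t a b)`. For `d = a`
they are `h1` and `h2`. For the root, with `h = b - a`, they follow from `6h - 13h² - 1 ≤ t`, whose
left side is at most `-4/13`, attained at `h = 3/13`. Both orders of the arguments are treated so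
that `a ≤ b` may be assumed later. -/
lemma min_rootBound_le_Gsup_near {t : ℝ} (ht : 0 ≤ t) (ht1 : t ≤ 1) (a b : unitInterval) (hab : a ≤ b)
    (h1 : (b : ℝ) ≤ 2 * a) (h2 : 2 * (b : ℝ) ≤ 1 + a) :
    min (a : ℝ) (rootBound t a b) ≤ Gsup t a b ∧ min (a : ℝ) (rootBound t a b) ≤ Gsup t b a := by
  have hab' : (a : ℝ) ≤ b := hab
  have e1 : (b : ℝ) - a ≤ rootBound t a b := by
    have : 2 * ((b : ℝ) - a) - (a + b - 1) ≤
      √(((a : ℝ) + b - 1) ^ 2 + 2 / 3 * (t + 1) + 2 / 3 * ((a : ℝ) - b) ^ 2) :=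
      Real.le_sqrt_of_sq_le (by
        nlinarith [mul_nonneg (sub_nonneg.2 hab') (sub_nonneg.2 h1),
          sq_nonneg ((b : ℝ) - a - 3 / 13)])
    rw [rootBound]
    linarith
  have e2 : (b : ℝ) - a ≤ rootBound t a b - (a + b - 1) := by
    have : 2 * ((b : ℝ) - a) + (a + b - 1) ≤
      √(((a : ℝ) + b - 1) ^ 2 + 2 / 3 * (t + 1) + 2 / 3 * ((a : ℝ) - b) ^ 2) :=
      Real.le_sqrt_of_sq_le (by
        nlinarith [mul_nonneg (sub_nonneg.2 hab') (sub_nonneg.2 h2),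
          sq_nonneg ((b : ℝ) - a - 3 / 13)])
    rw [rootBound]
    linarith
  set d := min (a : ℝ) (rootBound t a b) with hd
  have hda : d ≤ a := min_le_left _ _
  have hdE : d ≤ rootBound t a b := min_le_right _ _
  have g1 : (b : ℝ) - a ≤ d := le_min (by linarith) e1
  have g2 : (b : ℝ) - a ≤ d - (a + b - 1) := by
    have : (b : ℝ) - a + (a + b - 1) ≤ d := le_min (by linarith) (by linarith)
    linarith
  have g3 : 6 * (d * (d - (a + b - 1))) - ((a : ℝ) - b) ^ 2 - 1 ≤ t := by
    rw [← rootBound_eq (a := (a : ℝ)) (b := b) (by linarith : -1 ≤ t)]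
    have : d * (d - (a + b - 1)) ≤ rootBound t a b * (rootBound t a b - (a + b - 1)) :=
      mul_le_mul hdE (by linarith) (by linarith) (by linarith)
    linarith
  have habs : |(a : ℝ) - b| = b - a := by rw [abs_sub_comm, abs_of_nonneg (by linarith)]
  refine ⟨le_Gsup_of_le ht1 a b hda (by linarith) (by rw [habs]; exact g1)
    (by rw [habs]; exact g2) g3, le_Gsup_of_le ht1 b a (by linarith) hda
    (by rw [abs_sub_comm, habs]; exact g1) (by rw [abs_sub_comm, habs]; linarith) ?_⟩
  rw [add_comm (b : ℝ), sub_sq_comm (b : ℝ)]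
  exact g3

lemma le_Gsup_far {t : ℝ} (ht : 0 ≤ t) (ht1 : t ≤ 1) (a b : unitInterval)
    (h : 2 * (a : ℝ) ≤ b ∨ 1 + (a : ℝ) ≤ 2 * b) :
    (a : ℝ) ≤ Gsup t a b ∧ (a : ℝ) ≤ Gsup t b a := by
  have ha0 := a.2.1
  have ha1 := a.2.2
  -- `c = min (2a) ((1 + a) / 2)` is the edge of the near region on the line through `a`. The root
  -- there is at least `a`, so the supremum is at least `a` at `c`, and monotonicity extends this to
  -- `b`.
  obtain ⟨c, hcb, hac, hc1, hc2, hc3⟩ : ∃ c : unitInterval, c ≤ b ∧ (a : ℝ) ≤ c ∧ (c : ℝ) ≤ 2 * a ∧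
      2 * (c : ℝ) ≤ 1 + a ∧ 6 * ((a : ℝ) * (1 - c)) - ((a : ℝ) - c) ^ 2 - 1 ≤ 0 := by
    rcases le_total (3 * (a : ℝ)) 1 with h3 | h3
    · refine ⟨⟨2 * a, by linarith, by linarith⟩, ?_, ?_, le_rfl, ?_, ?_⟩
      · change 2 * (a : ℝ) ≤ b
        rcases h with h | h <;> linarith
      all_goals dsimp only
      · linarith
      · linarith
      · nlinarith [sq_nonneg ((a : ℝ) - 3 / 13)]
    · refine ⟨⟨(1 + a) / 2, by linarith, by linarith⟩, ?_, ?_, ?_, ?_, ?_⟩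
      · change (1 + (a : ℝ)) / 2 ≤ b
        rcases h with h | h <;> linarith
      all_goals dsimp only
      · linarith
      · linarith
      · linarith
      · nlinarith [sq_nonneg ((1 - (a : ℝ)) / 2 - 3 / 13)]
  have hE : (a : ℝ) ≤ rootBound t a c := le_rootBound (by
    refine le_trans (le_of_eq ?_) (hc3.trans ht)
    ring)
  have h4 := min_rootBound_le_Gsup_near ht ht1 a c hac hc1 hc2
  rw [min_eq_left hE] at h4
  have hq := isQuasiCopula_Gsup (by linarith : -1 ≤ t) ht1
  exact ⟨h4.1.trans (hq.mono_right _ _ _ hcb), h4.2.trans (hq.mono_left _ _ _ hcb)⟩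

lemma min_rootBound_le_Gsup {t : ℝ} (ht : 0 ≤ t) (ht1 : t ≤ 1) (a b : unitInterval) (hab : a ≤ b) :
    min (a : ℝ) (rootBound t a b) ≤ Gsup t a b ∧ min (a : ℝ) (rootBound t a b) ≤ Gsup t b a := by
  rcases le_total (2 * (a : ℝ)) b with h | h
  · exact (le_Gsup_far ht ht1 a b (Or.inl h)).imp (min_le_left _ _).trans
      (min_le_left _ _).trans
  rcases le_total (1 + (a : ℝ)) (2 * b) with h' | h'
  · exact (le_Gsup_far ht ht1 a b (Or.inr h')).imp (min_le_left _ _).trans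
      (min_le_left _ _).trans
  exact min_rootBound_le_Gsup_near ht ht1 a b hab h h'

/-- The explicit form of the pointwise supremum for nonnegative `t`. -/
theorem Gsup_eq_of_nonneg {t : ℝ} (ht : 0 ≤ t) (ht1 : t ≤ 1) (a b : unitInterval) :
    Gsup t a b = min (min (a : ℝ) b) (rootBound t a b) := by
  have ht' : -1 ≤ t := by linarith
  refine le_antisymm (le_min (Gsup_le ht' ht1 fun C hC ↦ le_min (hC.1.le_left a b)
    (hC.1.le_right a b)) (Gsup_le_rootBound ht' ht1 a b)) ?_
  rcases le_total a b with h | h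
  · rw [min_eq_left (show (a : ℝ) ≤ b from h)]
    exact (min_rootBound_le_Gsup ht ht1 a b h).1
  · rw [min_eq_right (show (b : ℝ) ≤ a from h), rootBound_comm]
    exact (min_rootBound_le_Gsup ht ht1 b a h).2

/-! ### Comparison with `M` and `W` -/

lemma Gsup_eq_M {t : ℝ} (ht : 1 / 2 ≤ t) (ht1 : t ≤ 1) : Gsup t = M := by
  ext a b
  rw [Gsup_eq_of_nonneg (by linarith) ht1, M, min_eq_left]
  have ha0 := a.2.1
  have ha1 := a.2.2
  have hb0 := b.2.1
  have hb1 := b.2.2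
  refine le_rootBound ?_
  rcases le_total (a : ℝ) b with h | h
  · rw [min_eq_left h]
    nlinarith [sq_nonneg ((a : ℝ) + b - 1), sq_nonneg ((a : ℝ) - b)]
  · rw [min_eq_right h]
    nlinarith [sq_nonneg ((a : ℝ) + b - 1), sq_nonneg ((a : ℝ) - b)]

lemma exists_coe_eq_half : ∃ p : unitInterval, (p : ℝ) = 1 / 2 :=
  ⟨⟨1 / 2, by norm_num, by norm_num⟩, rfl⟩

lemma Gsup_ne_M {t : ℝ} (ht : -1 ≤ t) (ht2 : t < 1 / 2) : Gsup t ≠ M := by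
  intro h
  obtain ⟨p, hp⟩ := exists_coe_eq_half
  have h1 := Gsup_le_rootBound ht (by linarith) p p
  have h2 := rootBound_eq (a := 1 / 2) (b := 1 / 2) ht
  have h3 : M p p = 1 / 2 := by simp [M, hp]
  rw [h, h3, hp] at h1
  nlinarith

lemma Gsup_ne_W {t : ℝ} (ht : 0 ≤ t) (ht1 : t ≤ 1) : Gsup t ≠ W := by
  intro h
  obtain ⟨p, hp⟩ := exists_coe_eq_half
  have h1 := Gsup_eq_of_nonneg ht ht1 p p
  have h3 : W p p = 0 := by simp only [W, hp]; norm_num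
  rw [h, h3, hp] at h1
  have h5 : 1 / 10 ≤ rootBound t (1 / 2) (1 / 2) := le_rootBound (by norm_num; linarith)
  have h6 : (1 / 10 : ℝ) ≤ min (min (1 / 2) (1 / 2)) (rootBound t (1 / 2) (1 / 2)) :=
    le_min (by norm_num) h5
  linarith

/-! ### Failure of the 2-increasing property for negative `t` -/

/-- With `k = 2/3 (t + 1)`, `hle` says that the bounds by `rootBound` allow nonnegative mass on a
square of side `h` centred on the diagonal. Squaring twice isolates what this demands of the centre.
-/
lemma two_mul_sq_le_of_sqrt_add_sqrt {s k h R : ℝ} (hk : 0 ≤ k) (hh : 0 < h) (hR : 0 ≤ R)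
    (hR2 : R ^ 2 = s ^ 2 + k + 2 / 3 * h ^ 2)
    (hle : 2 * R ≤ √((s - h) ^ 2 + k) + √((s + h) ^ 2 + k)) : 6 * s ^ 2 - 3 * k ≤ 2 * h ^ 2 := by
  have k1 := Real.sq_sqrt (by positivity : 0 ≤ (s - h) ^ 2 + k)
  have k2 := Real.sq_sqrt (by positivity : 0 ≤ (s + h) ^ 2 + k)
  generalize √((s - h) ^ 2 + k) = x at *
  generalize √((s + h) ^ 2 + k) = y at *
  have h1 : s ^ 2 + k + h ^ 2 / 3 ≤ x * y := by
    have := pow_le_pow_left₀ (by positivity) hle 2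
    linarith [(by ring : (x + y) ^ 2 = x ^ 2 + y ^ 2 + 2 * (x * y))]
  have h2 := pow_le_pow_left₀ (by positivity) h1 2
  rw [mul_pow, k1, k2, ← sub_nonneg] at h2
  have h3 : 0 ≤ h ^ 2 * (4 / 9 * (2 * h ^ 2 - (6 * s ^ 2 - 3 * k))) := h2.trans_eq (by ring)
  linarith [nonneg_of_mul_nonneg_right h3 (by positivity)]

/-- The square has side `h` and centre `((1 + s) / 2, (1 + s) / 2)`, and `(s + R) / 2` is the root
at its off-diagonal corners. The inequalities on `R` make that root attained by a copula; the last
one contradicts `two_mul_sq_le_of_sqrt_add_sqrt`. -/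
lemma exists_square_params {t : ℝ} (ht : -1 < t) (ht0 : t < 0) :
    ∃ s h R : ℝ, 0 ≤ s ∧ 0 < h ∧ R ^ 2 = s ^ 2 + 2 / 3 * (t + 1) + 2 / 3 * h ^ 2 ∧
      R ≤ 1 - h ∧ s + 2 * h ≤ R ∧ 2 * h ^ 2 < 6 * s ^ 2 - 3 * (2 / 3 * (t + 1)) := by
  -- As `h → 0`, negative mass needs `s² > (1 + t) / 3` and the root lies below `M` when `s² < 1 -
  -- 2/3 (t + 1)`. This `s²` is the midpoint of that interval, which is nonempty exactly because `t
  -- < 0`.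
  obtain ⟨s, hsn, hs2⟩ : ∃ s : ℝ, 0 ≤ s ∧ s ^ 2 = 1 / 3 - t / 6 :=
    ⟨√(1 / 3 - t / 6), Real.sqrt_nonneg _, Real.sq_sqrt (by linarith)⟩
  have hs1 : s < 1 := by nlinarith
  obtain ⟨h, hh0, hh1, hh2⟩ : ∃ h : ℝ, 0 < h ∧ h ≤ -t / 4 ∧ h ≤ (1 + t) / 12 :=
    ⟨min (-t / 4) ((1 + t) / 12), lt_min (by linarith) (by linarith), min_le_left _ _,
      min_le_right _ _⟩
  have hhh : h ^ 2 ≤ h / 12 := by nlinarith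
  have hsh : s * h ≤ h := by nlinarith
  refine ⟨s, h, √(s ^ 2 + 2 / 3 * (t + 1) + 2 / 3 * h ^ 2), hsn, hh0, Real.sq_sqrt ?_,
    Real.sqrt_le_iff.2 ⟨?_, ?_⟩, Real.le_sqrt_of_sq_le ?_, ?_⟩
  · linarith [sq_nonneg h]
  · linarith
  · linarith [sq_nonneg h, (by ring : (1 - h) ^ 2 = 1 - 2 * h + h ^ 2)]
  · linarith [sq_nonneg h, (by ring : (s + 2 * h) ^ 2 = s ^ 2 + 4 * (s * h) + 4 * h ^ 2)]
  · linarith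

/-- For negative `t` the pointwise supremum assigns a negative mass to a small square centred at a
point of the main diagonal. -/
lemma not_isCopula_Gsup {t : ℝ} (ht : -1 < t) (ht0 : t < 0) : ¬ IsCopula (Gsup t) := by
  intro hG
  obtain ⟨s, h, R, hsn, hh0, hR2, hR1, hRs, hlt⟩ := exists_square_params ht ht0
  let a : unitInterval := ⟨(1 + s - h) / 2, by linarith, by linarith⟩
  let b : unitInterval := ⟨(1 + s + h) / 2, by linarith, by linarith⟩
  have ha : (a : ℝ) = (1 + s - h) / 2 := rfl
  have hb : (b : ℝ) = (1 + s + h) / 2 := rfl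
  have habs : |(a : ℝ) - b| = h := by
    rw [abs_sub_comm, abs_of_nonneg] <;> rw [ha, hb] <;> linarith
  have h1 : (s + R) / 2 ≤ Gsup t a b := by
    refine le_Gsup_of_le (by linarith) a b ?_ ?_ ?_ ?_ ?_ <;> (try rw [habs]) <;>
      (try rw [ha]) <;> (try rw [hb])
    · linarith
    · linarith
    · linarith
    · linarith
    · nlinarith
  have h2 : (s + R) / 2 ≤ Gsup t b a := by
    refine le_Gsup_of_le (by linarith) b a ?_ ?_ ?_ ?_ ?_ <;> (try rw [abs_sub_comm, habs]) <;>
      (try rw [ha]) <;> (try rw [hb])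
    · linarith
    · linarith
    · linarith
    · linarith
    · nlinarith
  have h3 := Gsup_le_rootBound ht.le (by linarith) a a
  have h4 := Gsup_le_rootBound ht.le (by linarith) b b
  rw [rootBound, show (a : ℝ) + a - 1 = s - h by rw [ha]; ring, sub_self] at h3
  rw [rootBound, show (b : ℝ) + b - 1 = s + h by rw [hb]; ring, sub_self] at h4
  have hab : a ≤ b := by
    change (a : ℝ) ≤ b
    rw [ha, hb]
    linarith
  have h5 := hG.two_increasing a b a b hab hab
  have h6 := two_mul_sq_le_of_sqrt_add_sqrt (k := 2 / 3 * (t + 1)) (by linarith) hh0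
    (by linarith) hR2 (by norm_num at h3 h4 ⊢; linarith)
  linarith

/-! ### The 2-increasing property for nonnegative `t` -/

/-- One-sided derivative of a minimum: it is the derivative of an active function, and it is at most
the derivative of every active function. -/
lemma exists_hasDerivWithinAt_min {f g : ℝ → ℝ} {f' g' x : ℝ}
    (hf : HasDerivWithinAt f f' (Set.Ici x) x) (hg : HasDerivWithinAt g g' (Set.Ici x) x) :
    ∃ c, HasDerivWithinAt (fun y ↦ min (f y) (g y)) c (Set.Ici x) x ∧
      (f x ≤ g x → c ≤ f') ∧ (g x ≤ f x → c ≤ g') ∧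
      ((c = f' ∧ f x ≤ g x) ∨ (c = g' ∧ g x ≤ f x)) := by
  rcases lt_trichotomy (f x) (g x) with h | h | h
  · refine ⟨f', hf.congr_of_eventuallyEq ?_ (min_eq_left h.le), fun _ ↦ le_rfl,
      fun h' ↦ absurd h' h.not_ge, Or.inl ⟨rfl, h.le⟩⟩
    filter_upwards [hf.continuousWithinAt.eventually_lt hg.continuousWithinAt h] with y hy
    exact min_eq_left hy.le
  · refine ⟨min f' g', ?_, fun _ ↦ min_le_left _ _, fun _ ↦ min_le_right _ _, ?_⟩
    -- At a tie the right slope of the minimum is the minimum of the right slopes.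
    · rw [hasDerivWithinAt_iff_tendsto_slope, Set.Ici_sdiff_left] at hf hg ⊢
      refine (hf.min hg).congr' ?_
      filter_upwards [self_mem_nhdsWithin] with y hy
      have hy' : 0 ≤ (y - x)⁻¹ := inv_nonneg.2 (sub_nonneg.2 (le_of_lt hy))
      simp only [slope, vsub_eq_sub, smul_eq_mul]
      rw [← mul_min_of_nonneg _ _ hy', h, min_self, min_sub_sub_right]
    · rcases min_choice f' g' with h' | h'
      · exact Or.inl ⟨h', h.le⟩
      · exact Or.inr ⟨h', h.ge⟩
  · refine ⟨g', hg.congr_of_eventuallyEq ?_ (min_eq_right h.le), fun h' ↦ absurd h' h.not_ge,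
      fun _ ↦ le_rfl, Or.inr ⟨rfl, h.le⟩⟩
    filter_upwards [hg.continuousWithinAt.eventually_lt hf.continuousWithinAt h] with y hy
    exact min_eq_right hy.le

/-- The discriminant in `rootBound`. -/
noncomputable def disc (t a b : ℝ) : ℝ :=
  (a + b - 1) ^ 2 + 2 / 3 * (t + 1) + 2 / 3 * (a - b) ^ 2

lemma disc_pos {t : ℝ} (ht : 0 ≤ t) (a b : ℝ) : 0 < disc t a b := by
  unfold disc
  positivity

/-- The partial derivative of `rootBound` in the first variable. -/
noncomputable def rootBoundDeriv (t a b : ℝ) : ℝ :=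
  (1 + ((a + b - 1) + 2 / 3 * (a - b)) / √(disc t a b)) / 2

lemma hasDerivAt_rootBound {t : ℝ} (ht : 0 ≤ t) (a b : ℝ) :
    HasDerivAt (fun x ↦ rootBound t x b) (rootBoundDeriv t a b) a := by
  have hs : HasDerivAt (fun x : ℝ ↦ x + b - 1) 1 a :=
    ((hasDerivAt_id a).add_const b).sub_const 1
  have hd : HasDerivAt (fun x : ℝ ↦ x - b) 1 a := (hasDerivAt_id a).sub_const b
  have h1 : HasDerivAt (fun x ↦ disc t x b) (2 * (a + b - 1) + 2 / 3 * (2 * (a - b))) a := by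
    have := ((hs.pow 2).add_const (2 / 3 * (t + 1))).add ((hd.pow 2).const_mul (2 / 3))
    exact this.congr_deriv (by norm_num)
  have h2 := (hs.add (h1.sqrt (disc_pos ht a b).ne')).div_const 2
  refine h2.congr_deriv ?_
  rw [rootBoundDeriv]
  ring

lemma abs_num_le_sqrt_disc {t a b : ℝ} (ht : 0 ≤ t) (ha : a ∈ Set.Icc (0 : ℝ) 1)
    (hb : b ∈ Set.Icc (0 : ℝ) 1) : |(a + b - 1) + 2 / 3 * (a - b)| ≤ √(disc t a b) := by
  refine Real.abs_le_sqrt ?_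
  obtain ⟨ha0, ha1⟩ := ha
  obtain ⟨hb0, hb1⟩ := hb
  unfold disc
  nlinarith [mul_nonneg ha0 (sub_nonneg.2 ha1), mul_nonneg hb0 (sub_nonneg.2 hb1),
    sq_nonneg (a - b), sq_nonneg (b - 1 / 2), sq_nonneg (a - 1 / 2)]

lemma rootBoundDeriv_mem {t a b : ℝ} (ht : 0 ≤ t) (ha : a ∈ Set.Icc (0 : ℝ) 1)
    (hb : b ∈ Set.Icc (0 : ℝ) 1) : rootBoundDeriv t a b ∈ Set.Icc (0 : ℝ) 1 := by
  have hpos := Real.sqrt_pos.2 (disc_pos ht a b)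
  have h : |((a + b - 1) + 2 / 3 * (a - b)) / √(disc t a b)| ≤ 1 := by
    rw [abs_div, abs_of_pos hpos]
    exact (div_le_one hpos).2 (abs_num_le_sqrt_disc ht ha hb)
  obtain ⟨h1, h2⟩ := abs_le.1 h
  exact ⟨by rw [rootBoundDeriv]; linarith, by rw [rootBoundDeriv]; linarith⟩

lemma rootBound_mono_and_lipschitz {t b x y : ℝ} (ht : 0 ≤ t) (hb : b ∈ Set.Icc (0 : ℝ) 1)
    (hx : 0 ≤ x) (hxy : x ≤ y) (hy : y ≤ 1) :
    rootBound t x b ≤ rootBound t y b ∧ rootBound t y b ≤ rootBound t x b + (y - x) := by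
  have hc : ContinuousOn (fun x ↦ rootBound t x b) (Set.Icc 0 1) := fun z _ ↦
    (hasDerivAt_rootBound ht z b).continuousAt.continuousWithinAt
  have hmem : ∀ z ∈ interior (Set.Icc (0 : ℝ) 1), z ∈ Set.Icc (0 : ℝ) 1 := fun z hz ↦
    interior_subset hz
  refine ⟨monotoneOn_of_deriv_nonneg (convex_Icc 0 1) hc
    (fun z _ ↦ (hasDerivAt_rootBound ht z b).differentiableAt.differentiableWithinAt)
    (fun z hz ↦ ?_) ⟨hx, hxy.trans hy⟩ ⟨hx.trans hxy, hy⟩ hxy, ?_⟩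
  · rw [(hasDerivAt_rootBound ht z b).deriv]
    exact (rootBoundDeriv_mem ht (hmem z hz) hb).1
  · have := Convex.image_sub_le_mul_sub_of_deriv_le (convex_Icc 0 1) hc
      (fun z _ ↦ (hasDerivAt_rootBound ht z b).differentiableAt.differentiableWithinAt)
      (C := 1) (fun z hz ↦ by
        rw [(hasDerivAt_rootBound ht z b).deriv]
        exact (rootBoundDeriv_mem ht (hmem z hz) hb).2)
      x ⟨hx, hxy.trans hy⟩ y ⟨hx.trans hxy, hy⟩ hxy
    linarith

/-- The mixed second derivative of `rootBound` is nonnegative where `(2a - 1)(2b - 1) ≤ 1/3`. -/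
lemma rootBoundDeriv_mono {t a b₁ b₂ : ℝ} (ht : 0 ≤ t) (hb : b₁ ≤ b₂)
    (h1 : (2 * a - 1) * (2 * b₁ - 1) ≤ 1 / 3) (h2 : (2 * a - 1) * (2 * b₂ - 1) ≤ 1 / 3) :
    rootBoundDeriv t a b₁ ≤ rootBoundDeriv t a b₂ := by
  have hderiv : ∀ b, HasDerivAt (fun y ↦ rootBoundDeriv t a y)
      ((2 / 9 * (t + 1) + 2 / 3 * (- ((2 * a - 1) * (2 * b - 1)))) /
        (√(disc t a b) * disc t a b) / 2) b := by
    intro b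
    have hs : HasDerivAt (fun y : ℝ ↦ a + y - 1) 1 b :=
      ((hasDerivAt_id b).const_add a).sub_const 1
    have hd : HasDerivAt (fun y : ℝ ↦ a - y) (-1) b := (hasDerivAt_id b).const_sub a
    have k1 : HasDerivAt (fun y ↦ disc t a y) (2 * (a + b - 1) - 2 / 3 * (2 * (a - b))) b := by
      have := ((hs.pow 2).add_const (2 / 3 * (t + 1))).add ((hd.pow 2).const_mul (2 / 3))
      exact this.congr_deriv (by norm_num; ring)
    have hpos := disc_pos ht a b
    have hsq := Real.sqrt_pos.2 hpos
    have k2 := (((hs.add (hd.const_mul (2 / 3))).div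
      (k1.sqrt hpos.ne') hsq.ne').const_add 1).div_const 2
    refine k2.congr_deriv ?_
    simp only [Pi.add_apply]
    have hss : √(disc t a b) ^ 2 = disc t a b := Real.sq_sqrt hpos.le
    have hdd : disc t a b = (a + b - 1) ^ 2 + 2 / 3 * (t + 1) + 2 / 3 * (a - b) ^ 2 := rfl
    generalize √(disc t a b) = r at *
    rw [← hss]
    field_simp
    rw [hss, hdd]
    ring
  refine monotoneOn_of_deriv_nonneg (convex_Icc b₁ b₂)
    (fun z _ ↦ (hderiv z).continuousAt.continuousWithinAt)
    (fun z _ ↦ (hderiv z).differentiableAt.differentiableWithinAt) (fun z hz ↦ ?_)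
    ⟨le_rfl, hb⟩ ⟨hb, le_rfl⟩ hb
  rw [(hderiv z).deriv]
  rw [interior_Icc] at hz
  have hpos := disc_pos ht a z
  -- The product is affine in `z`, so the bounds at the two endpoints suffice.
  have : (2 * a - 1) * (2 * z - 1) ≤ 1 / 3 := by
    rcases le_total 0 (2 * a - 1) with h | h
    · nlinarith [hz.1, hz.2]
    · nlinarith [hz.1, hz.2]
  refine div_nonneg (div_nonneg (by linarith) (by positivity)) (by norm_num)

/-- If the root is at most `min a b`, then `t` is at most the value of the quadratic at `min a b`.
With `t ≥ 0` this forces `6 * min a b * (1 - max a b) ≥ 1 + (a - b)²`, which keeps the point in the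
region where the mixed derivative is nonnegative. -/
lemma mul_le_third_of_rootBound_le {t a b : ℝ} (ht : 0 ≤ t) (h1 : rootBound t a b ≤ a)
    (h2 : rootBound t a b ≤ b) : (2 * a - 1) * (2 * b - 1) ≤ 1 / 3 := by
  have h3 := rootBound_eq (a := a) (b := b) (by linarith : -1 ≤ t)
  have h4 := rootBound_sub_nonneg t a b
  set d := rootBound t a b
  rcases le_total a b with h | h
  · have : d * (d - (a + b - 1)) ≤ a * (1 - b) := by nlinarith
    nlinarith
  · have : d * (d - (a + b - 1)) ≤ b * (1 - a) := by nlinarith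
    nlinarith

/-- The explicit form of the pointwise supremum, on the plane. -/
noncomputable def cappedRoot (t b a : ℝ) : ℝ := min (min a b) (rootBound t a b)

/-- The right derivative in `a` is `1`, `0` or `rootBoundDeriv`, according to the active term.
Monotonicity and the Lipschitz bound of `rootBound` in `b` restrict which terms can be active at
`b₁` given the one at `b₂`. -/
lemma exists_rightDeriv_le {t a b₁ b₂ : ℝ} (ht : 0 ≤ t) (ha : a ∈ Set.Icc (0 : ℝ) 1)
    (hb₁ : 0 ≤ b₁) (hb : b₁ ≤ b₂) (hb₂ : b₂ ≤ 1) :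
    ∃ c₁ c₂, HasDerivWithinAt (cappedRoot t b₁) c₁ (Set.Ici a) a ∧
      HasDerivWithinAt (cappedRoot t b₂) c₂ (Set.Ici a) a ∧ c₁ ≤ c₂ := by
  have key : ∀ b, ∃ c, HasDerivWithinAt (cappedRoot t b) c (Set.Ici a) a ∧
      (b ≤ a → b ≤ rootBound t a b → c ≤ 0) ∧
      (rootBound t a b ≤ a → rootBound t a b ≤ b → c ≤ rootBoundDeriv t a b) ∧
      ((c = 1 ∧ a ≤ b ∧ a ≤ rootBound t a b) ∨ (c = 0 ∧ b ≤ a ∧ b ≤ rootBound t a b) ∨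
        (c = rootBoundDeriv t a b ∧ rootBound t a b ≤ a ∧ rootBound t a b ≤ b)) := by
    intro b
    obtain ⟨c, hc, hc1, hc2, hc3⟩ := exists_hasDerivWithinAt_min
      (hasDerivWithinAt_id a (Set.Ici a)) (hasDerivWithinAt_const a (Set.Ici a) b)
    obtain ⟨e, he, he1, he2, he3⟩ := exists_hasDerivWithinAt_min hc
      (hasDerivAt_rootBound ht a b).hasDerivWithinAt
    simp only [id] at hc1 hc2 hc3 he he1 he2 he3
    refine ⟨e, he, fun h1 h2 ↦ (he1 (by rwa [min_eq_right h1])).trans (hc2 h1),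
      fun h1 h2 ↦ he2 (le_min h1 h2), ?_⟩
    rcases he3 with ⟨h, h'⟩ | ⟨h, h'⟩
    · rcases hc3 with ⟨k, k'⟩ | ⟨k, k'⟩
      · rw [min_eq_left k'] at h'
        exact Or.inl ⟨h.trans k, k', h'⟩
      · rw [min_eq_right k'] at h'
        exact Or.inr (Or.inl ⟨h.trans k, k', h'⟩)
    · exact Or.inr (Or.inr ⟨h, le_min_iff.1 h'⟩)
  have m₁ : b₁ ∈ Set.Icc (0 : ℝ) 1 := ⟨hb₁, hb.trans hb₂⟩
  have m₂ : b₂ ∈ Set.Icc (0 : ℝ) 1 := ⟨hb₁.trans hb, hb₂⟩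
  obtain ⟨c₁, d₁, u₁, v₁, w₁⟩ := key b₁
  obtain ⟨c₂, d₂, u₂, v₂, w₂⟩ := key b₂
  have e₁ := rootBoundDeriv_mem ht ha m₁
  have e₂ := rootBoundDeriv_mem ht ha m₂
  have hmono := rootBound_mono_and_lipschitz ht ha hb₁ hb hb₂
  rw [rootBound_comm t b₁ a, rootBound_comm t b₂ a] at hmono
  refine ⟨c₁, c₂, d₁, d₂, ?_⟩
  rcases w₂ with ⟨k, -, -⟩ | ⟨k, k1, k2⟩ | ⟨k, k1, k2⟩
  · rcases w₁ with ⟨l, -, -⟩ | ⟨l, -, -⟩ | ⟨l, -, -⟩ <;> linarith [e₁.2]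
  · rw [k]
    exact u₁ (hb.trans k1) (by linarith [hmono.2])
  · have hE : rootBound t a b₁ ≤ a → rootBound t a b₁ ≤ b₁ → c₁ ≤ c₂ := fun l1 l2 ↦
      (v₁ l1 l2).trans (k ▸ rootBoundDeriv_mono ht hb (mul_le_third_of_rootBound_le ht l1 l2)
        (mul_le_third_of_rootBound_le ht k1 k2))
    rcases w₁ with ⟨l, l1, l2⟩ | ⟨l, -, -⟩ | ⟨l, l1, l2⟩
    -- Here `a ≤ rootBound t a b₁ ≤ rootBound t a b₂ ≤ a`, so there is a tie at `b₁` and the root is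
    -- active there as well.
    · exact hE (by linarith [hmono.1]) (by linarith [hmono.1])
    · linarith [e₂.1]
    · exact hE l1 l2

lemma continuous_cappedRoot {t : ℝ} (ht : 0 ≤ t) (b : ℝ) : Continuous (cappedRoot t b) := by
  have : Continuous fun x ↦ rootBound t x b :=
    continuous_iff_continuousAt.2 fun z ↦ (hasDerivAt_rootBound ht z b).continuousAt
  exact (continuous_id.min continuous_const).min this

lemma cappedRoot_two_increasing {t a₁ a₂ b₁ b₂ : ℝ} (ht : 0 ≤ t) (ha₁ : 0 ≤ a₁) (ha : a₁ ≤ a₂)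
    (ha₂ : a₂ ≤ 1) (hb₁ : 0 ≤ b₁) (hb : b₁ ≤ b₂) (hb₂ : b₂ ≤ 1) :
    0 ≤ cappedRoot t b₂ a₂ - cappedRoot t b₁ a₂ - cappedRoot t b₂ a₁ + cappedRoot t b₁ a₁ := by
  have h : ∀ a : ℝ, ∃ c : ℝ × ℝ, a ∈ Set.Icc (0 : ℝ) 1 →
      HasDerivWithinAt (cappedRoot t b₁) c.1 (Set.Ici a) a ∧
      HasDerivWithinAt (cappedRoot t b₂) c.2 (Set.Ici a) a ∧ c.1 ≤ c.2 := by
    intro a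
    by_cases ha : a ∈ Set.Icc (0 : ℝ) 1
    · obtain ⟨c₁, c₂, h⟩ := exists_rightDeriv_le ht ha hb₁ hb hb₂
      exact ⟨(c₁, c₂), fun _ ↦ h⟩
    · exact ⟨0, fun h ↦ absurd h ha⟩
  choose c hc using h
  have hm : ∀ x ∈ Set.Ico a₁ a₂, x ∈ Set.Icc (0 : ℝ) 1 := fun x hx ↦
    ⟨ha₁.trans hx.1, hx.2.le.trans ha₂⟩
  -- Ordered right derivatives give ordered increments over `[a₁, a₂]`, which is the 2-increasing
  -- inequality.
  have := image_le_of_deriv_right_le_deriv_boundary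
    (f := fun x ↦ cappedRoot t b₁ x - cappedRoot t b₁ a₁)
    (B := fun x ↦ cappedRoot t b₂ x - cappedRoot t b₂ a₁)
    (((continuous_cappedRoot ht b₁).sub continuous_const).continuousOn)
    (fun x hx ↦ (hc x (hm x hx)).1.sub_const _) (by simp)
    (((continuous_cappedRoot ht b₂).sub continuous_const).continuousOn)
    (fun x hx ↦ (hc x (hm x hx)).2.1.sub_const _) (fun x hx ↦ (hc x (hm x hx)).2.2)
    (Set.right_mem_Icc.2 ha)
  linarith

lemma isCopula_Gsup {t : ℝ} (ht : 0 ≤ t) (ht1 : t ≤ 1) : IsCopula (Gsup t) := by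
  have hq := isQuasiCopula_Gsup (by linarith : -1 ≤ t) ht1
  refine ⟨hq.mem_Icc, hq.right_zero, hq.left_zero, hq.right_one, hq.left_one,
    fun u₁ u₂ v₁ v₂ hu hv ↦ ?_⟩
  simp only [Gsup_eq_of_nonneg ht ht1]
  exact cappedRoot_two_increasing ht u₁.2.1 hu u₂.2.2 v₁.2.1 hv v₂.2.2

end GiniGamma

theorem mainTheorem3 :
    GiniGamma.Gsup (-1) = GiniGamma.W ∧
    (∀ t : ℝ, t ∈ Set.Icc (-1 : ℝ) 1 →
      ((GiniGamma.IsProperQuasiCopula (GiniGamma.Gsup t) ↔ -1 < t ∧ t < 0) ∧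
       ((GiniGamma.IsCopula (GiniGamma.Gsup t) ∧ GiniGamma.Gsup t ≠ GiniGamma.M ∧
          GiniGamma.Gsup t ≠ GiniGamma.W) ↔ 0 ≤ t ∧ t < 1 / 2) ∧
       (GiniGamma.Gsup t = GiniGamma.M ↔ 1 / 2 ≤ t ∧ t ≤ 1))) := by
  refine ⟨GiniGamma.Gsup_neg_one, fun t ⟨ht, ht1⟩ ↦ ⟨⟨fun h ↦ ⟨?_, ?_⟩, fun h ↦ ?_⟩,
    ⟨fun h ↦ ⟨?_, ?_⟩, fun h ↦ ?_⟩, ⟨fun h ↦ ⟨?_, ht1⟩, fun h ↦ GiniGamma.Gsup_eq_M h.1 h.2⟩⟩⟩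
  · refine lt_of_le_of_ne ht fun h' ↦ h.2 ?_
    rw [← h', GiniGamma.Gsup_neg_one]
    exact GiniGamma.isCopula_W
  · exact not_le.1 fun h' ↦ h.2 (GiniGamma.isCopula_Gsup h' ht1)
  · exact ⟨GiniGamma.isQuasiCopula_Gsup ht ht1, GiniGamma.not_isCopula_Gsup h.1 h.2⟩
  · by_contra! h'
    rcases eq_or_lt_of_le ht with h'' | h''
    · exact h.2.2 (h'' ▸ GiniGamma.Gsup_neg_one)
    · exact GiniGamma.not_isCopula_Gsup h'' h' h.1
  · exact not_le.1 fun h' ↦ h.2.1 (GiniGamma.Gsup_eq_M h' ht1)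
  · exact ⟨GiniGamma.isCopula_Gsup h.1 ht1, GiniGamma.Gsup_ne_M ht h.2,
      GiniGamma.Gsup_ne_W h.1 ht1⟩
  · exact not_lt.1 fun h' ↦ GiniGamma.Gsup_ne_M ht h' h
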